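/- Let $(\mathcal R,\mu)$ be a $\sigma$-finite resonant measure space. For a measurable function $f$ on $\mathcal R$ (extended complex-valued) let $f^*(t)=\inf\{s\in[0,\infty):\mu(\{|f|>s\})\le t\}$, $t\in[0,\infty)$, be its non-increasing rearrangement; resonant means that $\sup_{\tilde g^*=g^*}\int_{\mathcal R}|f\tilde g|\,d\mu=\int_0^\infty f^*g^*\,d\lambda$ for all measurable $f,g$. Let $\|\cdot\|_X$ be a rearrangement-invariant Banach function norm, i.e. a functional on the measurable functions with values in $[0,\infty]$ such that $\|f\|_X=\|\,|f|\,\|_X$, such that $\|f\|_X=\|g\|_X$ whenever $f^*=g^*$, and such that on non-negative functions it is absolutely homogeneous, subadditive, vanishes exactly at functions that are $0$ a.e., is monotone with respect to the a.e. order, has the Fatou property ($f_n\uparrow f$ a.e. implies $\|f_n\|_X\uparrow\|f\|_X$), satisfies $\|\chi_E\|_X<\infty$ whenever $\mu(E)<\infty$, and for each $E$ with $\mu(E)<\infty$ satisfies $\int_E f\,d\mu\le C_E\|f\|_X$ with a finite constant $C_E$. Let $X=\{f:\|f\|_X<\infty\}$ (functions equal a.e. being identified) be the corresponding r.i. Banach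 function space, and let $X'=\{\varphi:\|\varphi\|_{X'}<\infty\}$ be its associate space, where $\|\varphi\|_{X'}=\sup_{g\in X}\|g\|_X^{-1}\int_{\mathcal R}|\varphi g|\,d\mu$ (with $0/0=0$ and $a/0=\infty$ for $a>0$). Let $\xi$ be the locally convex topology on $X$ induced by the seminorms $$|f|_\varphi=\int_0^\infty \varphi^*f^*\,d\lambda,\qquad \varphi\in X'.$$ Then $(X,\xi)$ is complete: every Cauchy net in $(X,\xi)$ converges in $(X,\xi)$ to an element of $X$. -/

import Mathlib

open MeasureTheory Set Filter Topology
open scoped ENNReal NNReal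

noncomputable section

namespace RIBFS

variable {Ω : Type*} [MeasurableSpace Ω] {μ : Measure Ω}

/-- The non-increasing rearrangement `f^*(t) = inf {s ∈ [0, ∞) : μ {f > s} ≤ t}`, `t ∈ [0, ∞)`, of a
function with values in `[0, ∞]` (the modulus of an extended complex-valued function). The infimum of
the empty set is `∞`. The argument is a real number; only `t ≥ 0` is meaningful. -/
def rearrangement (μ : Measure Ω) (f : Ω → ℝ≥0∞) (t : ℝ) : ℝ≥0∞ :=
  ⨅ (s : ℝ≥0) (_ : μ {x | (s : ℝ≥0∞) < f x} ≤ ENNReal.ofReal t), (s : ℝ≥0∞)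

/-- Two functions are equimeasurable if their non-increasing rearrangements coincide. -/
def Equimeasurable (μ : Measure Ω) (f g : Ω → ℝ≥0∞) : Prop :=
  ∀ t : ℝ, 0 ≤ t → rearrangement μ f t = rearrangement μ g t

/-- The integral `∫_0^∞ f^* g^* dλ`. -/
def rearrangementPairing (μ : Measure Ω) (f g : Ω → ℝ≥0∞) : ℝ≥0∞ :=
  ∫⁻ t in Ici (0 : ℝ), rearrangement μ f t * rearrangement μ g t

/-- A measure space is resonant if `sup ∫ |f h| dμ = ∫_0^∞ f^* g^* dλ` for all measurable `f`, `g`,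
the supremum being taken over all measurable `h` equimeasurable with `g`. Only the moduli of the
functions enter, so it is stated for functions with values in `[0, ∞]`. -/
class IsResonant (μ : Measure Ω) : Prop where
  iSup_lintegral_eq : ∀ f g : Ω → ℝ≥0∞, Measurable f → Measurable g →
    (⨆ (h : Ω → ℝ≥0∞) (_ : Measurable h) (_ : Equimeasurable μ h g), ∫⁻ x, f x * h x ∂μ)
      = rearrangementPairing μ f g

/-- A Banach function norm. Since `‖f‖ = ‖ |f| ‖` for every extended complex-valued measurable `f`,
it is given by its values on the measurable functions with values in `[0, ∞]`; functions that are
equal almost everywhere have the same norm by the lattice property. The values of `toFun` on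
non-measurable functions are irrelevant. -/
structure BanachFunctionNorm (μ : Measure Ω) where
  toFun : (Ω → ℝ≥0∞) → ℝ≥0∞
  /-- absolute homogeneity -/
  smul' : ∀ (a : ℝ≥0) (f : Ω → ℝ≥0∞), Measurable f → toFun (fun x => a * f x) = a * toFun f
  /-- definiteness -/
  eq_zero_iff' : ∀ f : Ω → ℝ≥0∞, Measurable f → (toFun f = 0 ↔ f =ᵐ[μ] 0)
  /-- subadditivity -/
  add_le' : ∀ f g : Ω → ℝ≥0∞, Measurable f → Measurable g →
    toFun (fun x => f x + g x) ≤ toFun f + toFun g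
  /-- the lattice property -/
  mono' : ∀ f g : Ω → ℝ≥0∞, Measurable f → Measurable g → f ≤ᵐ[μ] g → toFun f ≤ toFun g
  /-- the Fatou property -/
  fatou' : ∀ (f : ℕ → Ω → ℝ≥0∞) (g : Ω → ℝ≥0∞), (∀ n, Measurable (f n)) → Measurable g →
    (∀ᵐ x ∂μ, Monotone (fun n => f n x) ∧ Tendsto (fun n => f n x) atTop (𝓝 (g x))) →
    Tendsto (fun n => toFun (f n)) atTop (𝓝 (toFun g))
  /-- characteristic functions of sets of finite measure have finite norm -/
  indicator_lt_top' : ∀ E : Set Ω, MeasurableSet E → μ E < ∞ → toFun (E.indicator 1) < ∞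
  /-- local embedding into `L¹` -/
  setLIntegral_le' : ∀ E : Set Ω, MeasurableSet E → μ E < ∞ →
    ∃ C : ℝ≥0, ∀ f : Ω → ℝ≥0∞, Measurable f → ∫⁻ x in E, f x ∂μ ≤ C * toFun f

/-- A rearrangement-invariant Banach function norm. -/
structure RIBanachFunctionNorm (μ : Measure Ω) extends BanachFunctionNorm μ where
  ri' : ∀ f g : Ω → ℝ≥0∞, Measurable f → Measurable g → Equimeasurable μ f g → toFun f = toFun g

/-- The associate functional `‖f‖_{X'} = sup {‖g‖_X⁻¹ ∫ |f g| dμ : g ∈ X}`. In `[0, ∞]` Lean's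
conventions are `0 / 0 = 0` and `a / 0 = ∞` for `a > 0`. -/
def BanachFunctionNorm.associate (ρ : BanachFunctionNorm μ) (f : Ω → ℝ≥0∞) : ℝ≥0∞ :=
  ⨆ (g : Ω → ℝ≥0∞) (_ : Measurable g) (_ : ρ.toFun g < ∞), (∫⁻ x, f x * g x ∂μ) / ρ.toFun g

/-- The modulus of (a representative of) an a.e.-class of complex-valued functions. -/
def modulus (f : Ω →ₘ[μ] ℂ) (x : Ω) : ℝ≥0∞ := ‖f x‖ₑ

lemma measurable_modulus (f : Ω →ₘ[μ] ℂ) : Measurable (modulus f) :=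
  f.measurable.enorm

lemma modulus_add_le (f g : Ω →ₘ[μ] ℂ) :
    modulus (f + g) ≤ᵐ[μ] fun x => modulus f x + modulus g x := by
  filter_upwards [AEEqFun.coeFn_add f g] with x hx
  simpa [modulus, hx] using enorm_add_le (f x) (g x)

lemma modulus_smul (c : ℂ) (f : Ω →ₘ[μ] ℂ) :
    modulus (c • f) =ᵐ[μ] fun x => (‖c‖₊ : ℝ≥0∞) * modulus f x := by
  filter_upwards [AEEqFun.coeFn_smul c f] with x hx
  simp [modulus, hx, enorm_eq_nnnorm]

/-- The Banach function space `X = {f : ‖f‖_X < ∞}`, as a space of a.e.-classes. By the local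
embedding into `L¹` and σ-finiteness every extended complex-valued function of finite norm is finite
a.e., so that complex-valued classes suffice. -/
def BanachFunctionNorm.space (ρ : BanachFunctionNorm μ) : Submodule ℂ (Ω →ₘ[μ] ℂ) where
  carrier := {f | ρ.toFun (modulus f) < ∞}
  add_mem' {f g} hf hg := by
    refine lt_of_le_of_lt (ρ.mono' _ _ (measurable_modulus _)
      ((measurable_modulus f).add (measurable_modulus g)) (modulus_add_le f g)) ?_
    exact lt_of_le_of_lt (ρ.add_le' _ _ (measurable_modulus f) (measurable_modulus g))
      (ENNReal.add_lt_top.2 ⟨hf, hg⟩)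
  zero_mem' := by
    have h : ρ.toFun (modulus (0 : Ω →ₘ[μ] ℂ)) = 0 := by
      rw [ρ.eq_zero_iff' _ (measurable_modulus _)]
      filter_upwards [AEEqFun.coeFn_zero (α := Ω) (β := ℂ) (μ := μ)] with x hx
      simp [modulus, hx]
    simp [h]
  smul_mem' c f hf := by
    refine lt_of_le_of_lt (ρ.mono' _ _ (measurable_modulus _)
      ((measurable_modulus f).const_mul _) (modulus_smul c f).le) ?_
    rw [ρ.smul' _ _ (measurable_modulus f)]
    exact ENNReal.mul_lt_top ENNReal.coe_lt_top hf

/-- The associate space `X' = {φ : ‖φ‖_{X'} < ∞}`. Its elements are finite a.e. because `X` contains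
the characteristic functions of sets of finite measure. -/
def BanachFunctionNorm.associateSpace (ρ : BanachFunctionNorm μ) : Set (Ω →ₘ[μ] ℂ) :=
  {φ | ρ.associate (modulus φ) < ∞}

/-- The functional `|f|_φ = ∫_0^∞ φ^* f^* dλ`, as an element of `[0, ∞]`. -/
def xiFunctional (φ f : Ω →ₘ[μ] ℂ) : ℝ≥0∞ :=
  rearrangementPairing μ (modulus φ) (modulus f)

lemma rearrangementPairing_comm (f g : Ω → ℝ≥0∞) :
    rearrangementPairing μ f g = rearrangementPairing μ g f := by
  simp only [rearrangementPairing, mul_comm]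

lemma lintegral_mul_le_associate (ρ : BanachFunctionNorm μ) {f g : Ω → ℝ≥0∞}
    (hg : Measurable g) (hgX : ρ.toFun g < ∞) :
    ∫⁻ x, f x * g x ∂μ ≤ ρ.associate f * ρ.toFun g := by
  rcases eq_or_ne (ρ.toFun g) 0 with h0 | h0
  · have hg0 := (ρ.eq_zero_iff' g hg).1 h0
    have : ∫⁻ x, f x * g x ∂μ = 0 := by
      rw [lintegral_congr_ae (g := fun _ => 0)]
      · simp
      · filter_upwards [hg0] with x hx
        simp [hx]
    simp [this]
  · rw [← ENNReal.div_le_iff h0 hgX.ne]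
    exact le_iSup_of_le g (le_iSup_of_le hg (le_iSup_of_le hgX le_rfl))

lemma xiFunctional_lt_top [IsResonant μ] (ρ : RIBanachFunctionNorm μ) {φ f : Ω →ₘ[μ] ℂ}
    (hφ : φ ∈ ρ.associateSpace) (hf : f ∈ ρ.space) : xiFunctional φ f < ∞ := by
  rw [xiFunctional, ← IsResonant.iSup_lintegral_eq _ _ (measurable_modulus φ)
    (measurable_modulus f)]
  refine lt_of_le_of_lt (iSup_le fun h => iSup_le fun hh => iSup_le fun he => ?_)
    (ENNReal.mul_lt_top (a := ρ.associate (modulus φ)) hφ hf)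
  have hr := ρ.ri' _ _ hh (measurable_modulus f) he
  rw [← hr]
  exact lintegral_mul_le_associate _ hh (hr ▸ hf)

lemma xiFunctional_eq_iSup [IsResonant μ] (φ f : Ω →ₘ[μ] ℂ) :
    xiFunctional φ f = ⨆ (h : Ω → ℝ≥0∞) (_ : Measurable h)
      (_ : Equimeasurable μ h (modulus φ)), ∫⁻ x, modulus f x * h x ∂μ := by
  rw [xiFunctional, rearrangementPairing_comm, ← IsResonant.iSup_lintegral_eq _ _
    (measurable_modulus f) (measurable_modulus φ)]

lemma xiFunctional_add_le [IsResonant μ] (φ f g : Ω →ₘ[μ] ℂ) :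
    xiFunctional φ (f + g) ≤ xiFunctional φ f + xiFunctional φ g := by
  simp only [xiFunctional_eq_iSup φ]
  refine iSup_le fun h => iSup_le fun hh => iSup_le fun he => ?_
  calc ∫⁻ x, modulus (f + g) x * h x ∂μ
      ≤ ∫⁻ x, (modulus f x * h x + modulus g x * h x) ∂μ := by
        refine lintegral_mono_ae ?_
        filter_upwards [modulus_add_le f g] with x hx
        rw [← add_mul]
        gcongr
    _ = ∫⁻ x, modulus f x * h x ∂μ + ∫⁻ x, modulus g x * h x ∂μ :=
        lintegral_add_left ((measurable_modulus f).mul hh) _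
    _ ≤ _ := by
        refine add_le_add ?_ ?_
        · exact le_iSup₂_of_le h hh
            (le_iSup (fun _ : Equimeasurable μ h (modulus φ) => ∫⁻ x, modulus f x * h x ∂μ) he)
        · exact le_iSup₂_of_le h hh
            (le_iSup (fun _ : Equimeasurable μ h (modulus φ) => ∫⁻ x, modulus g x * h x ∂μ) he)

lemma xiFunctional_smul [IsResonant μ] (φ : Ω →ₘ[μ] ℂ) (c : ℂ) (f : Ω →ₘ[μ] ℂ) :
    xiFunctional φ (c • f) = ‖c‖₊ * xiFunctional φ f := by
  simp only [xiFunctional_eq_iSup φ, ENNReal.mul_iSup]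
  refine iSup_congr fun h => iSup_congr fun hh => iSup_congr fun _ => ?_
  have hm : Measurable fun x => modulus f x * h x := (measurable_modulus f).mul hh
  rw [← lintegral_const_mul _ hm]
  refine lintegral_congr_ae ?_
  filter_upwards [modulus_smul c f] with x hx
  rw [hx, mul_assoc]

/-- The seminorm `|·|_φ` on `X`, for `φ ∈ X'` (a norm when `φ ≠ 0`). -/
def xiSeminorm [IsResonant μ] (ρ : RIBanachFunctionNorm μ) (φ : ρ.associateSpace) :
    Seminorm ℂ ρ.space :=
  Seminorm.of (fun f => (xiFunctional (φ : Ω →ₘ[μ] ℂ) (f : Ω →ₘ[μ] ℂ)).toReal)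
    (fun f g => by
      have hf := (xiFunctional_lt_top ρ φ.2 f.2).ne
      have hg := (xiFunctional_lt_top ρ φ.2 g.2).ne
      rw [← ENNReal.toReal_add hf hg]
      exact ENNReal.toReal_mono (ENNReal.add_ne_top.2 ⟨hf, hg⟩) (xiFunctional_add_le _ _ _))
    (fun c f => by
      rw [Submodule.coe_smul, xiFunctional_smul]
      simp)

/-- The uniform structure on `X` generated by the family of seminorms `|·|_φ`, `φ ∈ X'`. -/
@[reducible] def xiUniformSpace [IsResonant μ] (ρ : RIBanachFunctionNorm μ) :
    UniformSpace ρ.space :=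
  ⨅ φ : ρ.associateSpace, (xiSeminorm ρ φ).toSeminormedAddCommGroup.toUniformSpace

/-- The rearrangement-invariant locally convex topology `ξ` on `X`. -/
@[reducible] def xiTopology [IsResonant μ] (ρ : RIBanachFunctionNorm μ) :
    TopologicalSpace ρ.space :=
  (xiUniformSpace ρ).toTopologicalSpace

/-- `xiUniformSpace` is the translation-invariant uniform structure of `(X, ξ)`. -/
lemma isUniformAddGroup_xi [IsResonant μ] (ρ : RIBanachFunctionNorm μ) :
    @IsUniformAddGroup ρ.space (xiUniformSpace ρ) _ :=
  isUniformAddGroup_iInf fun φ =>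
    (xiSeminorm ρ φ).toSeminormedAddCommGroup.to_isUniformAddGroup

/-- `ξ` is the locally convex topology induced by the seminorms `|·|_φ`, `φ ∈ X'`. -/
lemma withSeminorms_xi [IsResonant μ] (ρ : RIBanachFunctionNorm μ) :
    @WithSeminorms ℂ ρ.space ρ.associateSpace _ _ _ (xiSeminorm ρ) (xiTopology ρ) := by
  letI := xiUniformSpace ρ
  haveI := isUniformAddGroup_xi ρ
  exact (SeminormFamily.withSeminorms_iff_uniformSpace_eq_iInf (xiSeminorm ρ)).2 rfl

end RIBFS

end

namespace RIBFS

variable {Ω : Type*} [MeasurableSpace Ω] {μ : Measure Ω}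

/-! Characteristic functions of sets of finite measure lie in `X'`, so a `ξ`-Cauchy filter is Cauchy
in `L¹` on every such set. By σ-finiteness it contains a decreasing sequence of sets, the `n`-th of
`L¹`-diameter at most `2⁻ⁿ` on the `n`-th set of an exhaustion. All selections from this sequence
converge a.e. to one common limit `g` (`exists_forall_tendsto_ae`), which is the candidate.

By resonance `|·|_φ` is a supremum of integrals against functions equimeasurable with `φ`, hence
lower semicontinuous under a.e. convergence by Fatou's lemma. Selecting inside a member of the
filter of `φ`-diameter at most `ε` therefore gives `|f - g|_φ ≤ ε` for every `f` in that member.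

It remains to see that `g ∈ X`. The estimate makes every `|g|_φ` finite. If `‖g‖_X = ∞`, the
Lorentz–Luxemburg theorem gives `ψ_k` in the unit ball of `X'` with `∫ ψ_k |g| ≥ 4ᵏ`, and `∑ 2⁻ᵏ
ψ_k` is an element of `X'` whose pairing with `g` is infinite. -/

/-! ### Truncations -/

/-- Truncation of a function in height and to the sets of a finite-measure exhaustion. -/
noncomputable def truncation (μ : Measure Ω) [SigmaFinite μ] (n : ℕ) (F : Ω → ℝ≥0∞) : Ω → ℝ≥0∞ :=
  (spanningSets μ n).indicator fun x => min (F x) n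

section truncation

variable [SigmaFinite μ]

lemma measurable_truncation (n : ℕ) {F : Ω → ℝ≥0∞} (hF : Measurable F) :
    Measurable (truncation μ n F) :=
  (hF.min measurable_const).indicator (measurableSet_spanningSets μ n)

lemma truncation_le_natCast (n : ℕ) (F : Ω → ℝ≥0∞) (x : Ω) : truncation μ n F x ≤ n :=
  indicator_le' (fun _ _ => min_le_right _ _) (fun _ _ => zero_le) x

lemma truncation_le (n : ℕ) (F : Ω → ℝ≥0∞) (x : Ω) : truncation μ n F x ≤ F x :=
  indicator_le' (fun _ _ => min_le_left _ _) (fun _ _ => zero_le) x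

lemma truncation_ne_top (n : ℕ) (F : Ω → ℝ≥0∞) (x : Ω) : truncation μ n F x ≠ ∞ :=
  ne_top_of_le_ne_top (ENNReal.natCast_ne_top n) (truncation_le_natCast n F x)

lemma monotone_truncation (F : Ω → ℝ≥0∞) : Monotone fun n => truncation μ n F := by
  intro m n hmn x
  refine (indicator_le_indicator_of_subset (monotone_spanningSets μ hmn)
    (fun _ => zero_le) x).trans (indicator_le_indicator ?_)
  exact min_le_min le_rfl (Nat.cast_le.2 hmn)

lemma tendsto_truncation (F : Ω → ℝ≥0∞) (x : Ω) :
    Tendsto (fun n => truncation μ n F x) atTop (𝓝 (F x)) := by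
  have h : Tendsto (fun n : ℕ => min (F x) (n : ℝ≥0∞)) atTop (𝓝 (min (F x) ∞)) :=
    tendsto_const_nhds.min ENNReal.tendsto_nat_nhds_top
  rw [min_eq_left le_top] at h
  refine h.congr' ?_
  filter_upwards [eventually_ge_atTop (spanningSetsIndex μ x)] with n hn
  rw [truncation, indicator_of_mem (mem_spanningSets_of_index_le μ x hn)]

lemma iSup_truncation (F : Ω → ℝ≥0∞) (x : Ω) : ⨆ n, truncation μ n F x = F x :=
  tendsto_nhds_unique
    (tendsto_atTop_iSup fun _ _ h => monotone_truncation F h x) (tendsto_truncation F x)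

/-- Every measurable function that is dominated by a truncation is square integrable. -/
lemma memLp_two_of_enorm_le_truncation {n : ℕ} {F : Ω → ℝ≥0∞} {f : Ω → ℝ} (hf : Measurable f)
    (h : ∀ x, ‖f x‖ₑ ≤ truncation μ n F x) : MemLp f 2 μ := by
  have hi : MemLp ((spanningSets μ n).indicator fun _ => (n : ℝ)) 2 μ :=
    memLp_indicator_const 2 (measurableSet_spanningSets μ n) _
      (Or.inr (measure_spanningSets_lt_top μ n).ne)
  refine hi.of_le_enorm hf.aestronglyMeasurable (ae_of_all _ fun x => (h x).trans ?_)
  by_cases hx : x ∈ spanningSets μ n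
  · simpa [hx] using truncation_le_natCast n F x
  · simp [truncation, hx]

end truncation

/-- The Fatou property for almost everywhere convergent sequences. -/
lemma BanachFunctionNorm.le_of_tendsto_ae (ρ : BanachFunctionNorm μ) {f : ℕ → Ω → ℝ≥0∞}
    {g : Ω → ℝ≥0∞} {c : ℝ≥0∞} (hf : ∀ n, Measurable (f n)) (hg : Measurable g)
    (hc : ∀ n, ρ.toFun (f n) ≤ c) (h : ∀ᵐ x ∂μ, Tendsto (fun n => f n x) atTop (𝓝 (g x))) :
    ρ.toFun g ≤ c := by
  -- The tail infima increase to the limit inferior, so the monotone Fatou property applies to them.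
  have hm : ∀ n, Measurable fun x => ⨅ k, f (n + k) x := fun n => .iInf fun k => hf _
  refine le_of_tendsto (ρ.fatou' (fun n x => ⨅ k, f (n + k) x) g hm hg ?_)
    (Eventually.of_forall fun n => (ρ.mono' _ _ (hm n) (hf n)
      (ae_of_all _ fun x => (iInf_le _ 0))).trans (hc n))
  filter_upwards [h] with x hx
  have hmono : Monotone fun n => ⨅ k, f (n + k) x := fun m n hmn =>
    le_iInf fun k => (iInf_le _ (n - m + k)).trans_eq (by congr 1; omega)
  refine ⟨hmono, ?_⟩
  have h1 := tendsto_atTop_iSup hmono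
  have h2 := hx.liminf_eq
  rw [liminf_eq_iSup_iInf_of_nat'] at h2
  simp only [add_comm _ _] at h2 h1 ⊢
  rwa [h2] at h1

lemma BanachFunctionNorm.congr_ae (ρ : BanachFunctionNorm μ) {f g : Ω → ℝ≥0∞}
    (hf : Measurable f) (hg : Measurable g) (h : f =ᵐ[μ] g) : ρ.toFun f = ρ.toFun g :=
  le_antisymm (ρ.mono' _ _ hf hg h.le) (ρ.mono' _ _ hg hf h.symm.le)

/-! ### Unit balls in `L²` and the Lorentz–Luxemburg theorem -/

/-- The square integrable functions in the unit ball of a Banach function norm. -/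
def BanachFunctionNorm.unitBall (ρ : BanachFunctionNorm μ) : Set (Lp ℝ 2 μ) :=
  {f | ρ.toFun (fun x => ‖f x‖ₑ) ≤ 1}

lemma measurable_enorm_Lp (f : Lp ℝ 2 μ) : Measurable fun x => ‖f x‖ₑ :=
  (Lp.stronglyMeasurable f).measurable.enorm

lemma BanachFunctionNorm.toLp_mem_unitBall (ρ : BanachFunctionNorm μ) {f : Ω → ℝ}
    (hf : Measurable f) (hf2 : MemLp f 2 μ) :
    hf2.toLp f ∈ ρ.unitBall ↔ ρ.toFun (fun x => ‖f x‖ₑ) ≤ 1 := by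
  rw [unitBall, mem_ofPred_eq, ρ.congr_ae (measurable_enorm_Lp _) hf.enorm]
  filter_upwards [hf2.coeFn_toLp] with x hx
  rw [hx]

lemma BanachFunctionNorm.convex_unitBall (ρ : BanachFunctionNorm μ) : Convex ℝ ρ.unitBall := by
  intro f hf g hg a b ha hb hab
  lift a to ℝ≥0 using ha
  lift b to ℝ≥0 using hb
  have hab' : a + b = 1 := by exact_mod_cast hab
  have hfm := measurable_enorm_Lp f
  have hgm := measurable_enorm_Lp g
  calc ρ.toFun (fun x => ‖((a : ℝ) • f + (b : ℝ) • g : Lp ℝ 2 μ) x‖ₑ)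
      ≤ ρ.toFun (fun x => a * ‖f x‖ₑ + b * ‖g x‖ₑ) := by
        refine ρ.mono' _ _ (measurable_enorm_Lp _)
          ((hfm.const_mul _).add (hgm.const_mul _)) ?_
        filter_upwards [Lp.coeFn_add ((a : ℝ) • f) ((b : ℝ) • g), Lp.coeFn_smul (a : ℝ) f,
          Lp.coeFn_smul (b : ℝ) g] with x h1 h2 h3
        rw [h1, Pi.add_apply, h2, h3]
        refine (enorm_add_le _ _).trans_eq ?_
        simp [enorm_eq_nnnorm]
    _ ≤ a * ρ.toFun (fun x => ‖f x‖ₑ) + b * ρ.toFun (fun x => ‖g x‖ₑ) := by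
        rw [← ρ.smul' _ _ hfm, ← ρ.smul' _ _ hgm]
        exact ρ.add_le' _ _ (hfm.const_mul _) (hgm.const_mul _)
    _ ≤ a * 1 + b * 1 := by gcongr <;> assumption
    _ = 1 := by simpa using by exact_mod_cast hab'

/-- An `L²`-convergent sequence has an a.e. convergent subsequence, to which the Fatou property
applies. -/
lemma BanachFunctionNorm.isClosed_unitBall (ρ : BanachFunctionNorm μ) :
    IsClosed ρ.unitBall := by
  refine IsSeqClosed.isClosed fun f g hf hfg => ?_
  obtain ⟨ns, -, hns⟩ := (tendstoInMeasure_of_tendsto_Lp hfg).exists_seq_tendsto_ae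
  refine ρ.le_of_tendsto_ae (fun n => measurable_enorm_Lp (f (ns n))) (measurable_enorm_Lp g)
    (fun n => hf (ns n)) ?_
  filter_upwards [hns] with x hx
  exact hx.enorm

lemma BanachFunctionNorm.zero_mem_unitBall (ρ : BanachFunctionNorm μ) :
    (0 : Lp ℝ 2 μ) ∈ ρ.unitBall := by
  have h : ρ.toFun (fun x => ‖(0 : Lp ℝ 2 μ) x‖ₑ) = 0 := by
    rw [ρ.eq_zero_iff' _ (measurable_enorm_Lp _)]
    filter_upwards [Lp.coeFn_zero ℝ 2 μ] with x hx
    rw [hx]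
    simp
  exact h.le.trans zero_le_one

lemma BanachFunctionNorm.associate_le_of_forall_unit (ρ : BanachFunctionNorm μ) {ψ : Ω → ℝ≥0∞}
    {c : ℝ≥0∞}
    (h : ∀ F, Measurable F → ρ.toFun F ≤ 1 → ∫⁻ x, ψ x * F x ∂μ ≤ c) : ρ.associate ψ ≤ c := by
  refine iSup_le fun F => iSup_le fun hF => iSup_le fun hFX => ?_
  rcases eq_or_ne (ρ.toFun F) 0 with h0 | h0
  · have hF0 := (ρ.eq_zero_iff' F hF).1 h0
    have : ∫⁻ x, ψ x * F x ∂μ = 0 := by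
      rw [lintegral_congr_ae (g := fun _ => 0)]
      · simp
      · filter_upwards [hF0] with x hx
        simp [hx]
    simp [this]
  · obtain ⟨r, hr⟩ : ∃ r : ℝ≥0, (r : ℝ≥0∞) = ρ.toFun F := ⟨_, ENNReal.coe_toNNReal hFX.ne⟩
    have hr0 : r ≠ 0 := by rintro rfl; exact h0 (by simpa using hr.symm)
    have hs : ρ.toFun (fun x => (r⁻¹ : ℝ≥0) * F x) ≤ 1 := by
      rw [ρ.smul' _ _ hF, ← hr, ← ENNReal.coe_mul, inv_mul_cancel₀ hr0, ENNReal.coe_one]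
    have := h _ (hF.const_mul _) hs
    simp only [mul_left_comm (ψ _)] at this
    rw [lintegral_const_mul' _ _ ENNReal.coe_ne_top, ENNReal.coe_inv hr0, hr] at this
    rwa [ENNReal.div_eq_inv_mul]

/-- The Lorentz–Luxemburg theorem: a Banach function norm is dominated by its second associate. -/
theorem BanachFunctionNorm.exists_associate_le_one [SigmaFinite μ] (ρ : BanachFunctionNorm μ)
    {G : Ω → ℝ≥0∞} (hG : Measurable G) {c : ℝ≥0} (hc0 : c ≠ 0) (hc : c < ρ.toFun G) :
    ∃ ψ : Ω → ℝ≥0∞, Measurable ψ ∧ ρ.associate ψ ≤ 1 ∧ c ≤ ∫⁻ x, ψ x * G x ∂μ := by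
  -- By the Fatou property some truncation `H` still has norm above `c`; it is square integrable, so
  -- Hilbert space duality is available.
  obtain ⟨n, hn⟩ : ∃ n, c < ρ.toFun (truncation μ n G) :=
    ((ρ.fatou' _ G (fun n => measurable_truncation n hG) hG (ae_of_all _ fun x =>
      ⟨fun _ _ h => monotone_truncation G h x, tendsto_truncation G x⟩)).eventually_const_lt
        hc).exists
  set H := truncation μ n G
  have hH : Measurable H := measurable_truncation n hG
  have hHt : ∀ x, H x ≠ ∞ := truncation_ne_top n G
  have henorm : ∀ x, ‖(H x).toReal‖ₑ = H x := fun x => by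
    rw [Real.enorm_of_nonneg ENNReal.toReal_nonneg, ENNReal.ofReal_toReal (hHt x)]
  have hg2 : MemLp (fun x => (H x).toReal) 2 μ :=
    memLp_two_of_enorm_le_truncation hH.ennreal_toReal fun x => (henorm x).le
  have hs2 : MemLp (fun x => (c⁻¹ : ℝ≥0) * (H x).toReal) 2 μ := hg2.const_mul _
  have hnot : hs2.toLp _ ∉ ρ.unitBall := by
    rw [ρ.toLp_mem_unitBall (hH.ennreal_toReal.const_mul _)]
    have : (fun x => ‖(c⁻¹ : ℝ≥0) * (H x).toReal‖ₑ) = fun x => ((c⁻¹ : ℝ≥0) : ℝ≥0∞) * H x := by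
      ext x
      rw [enorm_mul, henorm]
      simp [enorm_eq_nnnorm]
    rw [this, ρ.smul' _ _ hH, not_le, ENNReal.coe_inv hc0, ← ENNReal.div_eq_inv_mul]
    rwa [ENNReal.lt_div_iff_mul_lt (by simp [hc0]) (by simp), one_mul]
  obtain ⟨L, u, hL, hu⟩ :=
    geometric_hahn_banach_closed_point ρ.convex_unitBall ρ.isClosed_unitBall hnot
  have hu0 : 0 < u := by simpa using hL 0 ρ.zero_mem_unitBall
  -- The Riesz representative of the separating functional; `|v| / u` will be the required `ψ`.
  set v : Lp ℝ 2 μ := (InnerProductSpace.toDual ℝ (Lp ℝ 2 μ)).symm L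
  have hv : Measurable v := (Lp.stronglyMeasurable v).measurable
  have hLv : ∀ {f : Ω → ℝ} (hf : MemLp f 2 μ), L (hf.toLp f) = ∫ x, v x * f x ∂μ := by
    intro f hf
    rw [← InnerProductSpace.toDual_symm_apply, L2.inner_def]
    refine integral_congr_ae ?_
    filter_upwards [hf.coeFn_toLp] with x hx
    rw [hx]
    simp [mul_comm, v]
  have hint : ∀ {f : Ω → ℝ}, MemLp f 2 μ → Integrable (fun x => v x * f x) μ := fun hf =>
    (Lp.memLp v).integrable_mul hf
  -- the functional `|v|` is bounded by `u` on the unit ball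
  have hball : ∀ F, Measurable F → ρ.toFun F ≤ 1 →
      ∫⁻ x, ‖v x‖ₑ * F x ∂μ ≤ ENNReal.ofReal u := by
    intro F hF hF1
    have hsup : ∫⁻ x, ‖v x‖ₑ * F x ∂μ = ⨆ k, ∫⁻ x, ‖v x‖ₑ * truncation μ k F x ∂μ := by
      rw [← lintegral_iSup (f := fun k x => ‖v x‖ₑ * truncation μ k F x)
        (fun k => hv.enorm.mul (measurable_truncation k hF))
        (fun i j hij x => mul_le_mul_right (monotone_truncation F hij x) _)]
      simp_rw [← ENNReal.mul_iSup, iSup_truncation]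
    rw [hsup]
    refine iSup_le fun k => ?_
    have hTt := truncation_ne_top (μ := μ) k F
    set T := truncation μ k F
    have hT : Measurable T := measurable_truncation k hF
    -- Multiplying by the sign of `v` keeps `f` in the ball, which depends on moduli only, and turns
    -- `L f` into `∫ |v| T`.
    set f : Ω → ℝ := fun x => (if 0 ≤ v x then 1 else -1) * (T x).toReal
    have hf : Measurable f := by
      refine Measurable.mul (Measurable.ite (hv measurableSet_Ici) ?_ ?_) hT.ennreal_toReal
      all_goals exact measurable_const
    have hfe : ∀ x, ‖f x‖ₑ = T x := fun x => by
      have : ‖(T x).toReal‖ₑ = T x := by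
        rw [Real.enorm_of_nonneg ENNReal.toReal_nonneg, ENNReal.ofReal_toReal (hTt x)]
      simp only [f, enorm_mul, this]
      split_ifs <;> simp
    have hvf : ∀ x, v x * f x = ‖v x * f x‖ := fun x => by
      rw [Real.norm_eq_abs, eq_comm, abs_eq_self]
      simp only [f, ← mul_assoc]
      refine mul_nonneg ?_ ENNReal.toReal_nonneg
      split_ifs with h <;> linarith
    have hf2 : MemLp f 2 μ := memLp_two_of_enorm_le_truncation hf fun x => (hfe x).le
    have hmem : hf2.toLp f ∈ ρ.unitBall := by
      rw [ρ.toLp_mem_unitBall hf]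
      simp only [hfe]
      exact (ρ.mono' _ _ hT hF (ae_of_all _ (truncation_le k F))).trans hF1
    have h1 := hL _ hmem
    rw [hLv hf2] at h1
    calc ∫⁻ x, ‖v x‖ₑ * T x ∂μ = ∫⁻ x, ‖v x * f x‖ₑ ∂μ := by simp only [enorm_mul, hfe]
      _ = ENNReal.ofReal (∫ x, ‖v x * f x‖ ∂μ) :=
        (ofReal_integral_norm_eq_lintegral_enorm (hint hf2)).symm
      _ ≤ ENNReal.ofReal u := by
        simp only [← hvf]
        exact ENNReal.ofReal_le_ofReal h1.le
  have hut : ENNReal.ofReal u ≠ 0 := by simpa using hu0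
  refine ⟨fun x => (ENNReal.ofReal u)⁻¹ * ‖v x‖ₑ, hv.enorm.const_mul _, ?_, ?_⟩
  · refine ρ.associate_le_of_forall_unit fun F hF hF1 => ?_
    simp only [mul_assoc]
    rw [lintegral_const_mul' _ _ (ENNReal.inv_ne_top.2 hut), ← ENNReal.div_eq_inv_mul]
    exact ENNReal.div_le_of_le_mul (by simpa using hball F hF hF1)
  · simp only [mul_assoc]
    rw [lintegral_const_mul' _ _ (ENNReal.inv_ne_top.2 hut), ← ENNReal.div_eq_inv_mul,
      ENNReal.le_div_iff_mul_le (Or.inl hut) (Or.inl ENNReal.ofReal_ne_top)]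
    rw [hLv hs2] at hu
    -- Separation says `u < L (c⁻¹ H)`; passing to moduli only enlarges the right-hand side.
    have h2 : u ≤ (c : ℝ)⁻¹ * ∫ x, ‖v x * (H x).toReal‖ ∂μ := by
      refine hu.le.trans ?_
      simp only [mul_left_comm (v _), NNReal.coe_inv]
      rw [integral_const_mul]
      refine mul_le_mul_of_nonneg_left ?_ (by positivity)
      exact (Real.le_norm_self _).trans (norm_integral_le_integral_norm _)
    have h3 : (c : ℝ) * u ≤ ∫ x, ‖v x * (H x).toReal‖ ∂μ := by
      have hcpos : (0 : ℝ) < c := by positivity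
      rwa [inv_mul_eq_div, le_div_iff₀' hcpos] at h2
    calc (c : ℝ≥0∞) * ENNReal.ofReal u = ENNReal.ofReal (c * u) := by
          rw [ENNReal.ofReal_mul NNReal.zero_le_coe, ENNReal.ofReal_coe_nnreal]
      _ ≤ ENNReal.ofReal (∫ x, ‖v x * (H x).toReal‖ ∂μ) := ENNReal.ofReal_le_ofReal h3
      _ = ∫⁻ x, ‖v x * (H x).toReal‖ₑ ∂μ := ofReal_integral_norm_eq_lintegral_enorm (hint hg2)
      _ ≤ ∫⁻ x, ‖v x‖ₑ * G x ∂μ := by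
          refine lintegral_mono fun x => ?_
          rw [enorm_mul, henorm]
          gcongr
          exact truncation_le n G x

/-! ### The associate space and membership in `X` -/

lemma modulus_sub (f g : Ω →ₘ[μ] ℂ) : modulus (f - g) =ᵐ[μ] fun x => edist (f x) (g x) := by
  filter_upwards [AEEqFun.coeFn_sub f g] with x hx
  rw [modulus, hx, Pi.sub_apply, edist_eq_enorm_sub]

lemma BanachFunctionNorm.associate_congr_ae (ρ : BanachFunctionNorm μ) {f g : Ω → ℝ≥0∞}
    (h : f =ᵐ[μ] g) : ρ.associate f = ρ.associate g := by
  refine iSup_congr fun F => iSup_congr fun _ => iSup_congr fun _ => ?_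
  congr 1
  refine lintegral_congr_ae ?_
  filter_upwards [h] with x hx
  rw [hx]

/-- Functions of finite associate norm are finite almost everywhere. -/
lemma BanachFunctionNorm.ae_lt_top_of_associate_lt_top [SigmaFinite μ] (ρ : BanachFunctionNorm μ)
    {ψ : Ω → ℝ≥0∞} (hψ : Measurable ψ) (h : ρ.associate ψ < ∞) : ∀ᵐ x ∂μ, ψ x < ∞ := by
  refine ae_of_forall_measure_lt_top_ae_restrict _ fun E hE hμE => ?_
  refine ae_lt_top hψ ?_
  have hX := ρ.indicator_lt_top' E hE hμE
  have h1 := lintegral_mul_le_associate ρ (f := ψ) (measurable_one.indicator hE) hX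
  rw [← lintegral_indicator hE]
  refine ne_top_of_le_ne_top (ENNReal.mul_lt_top h hX).ne (le_trans (le_of_eq ?_) h1)
  congr 1 with x
  by_cases hx : x ∈ E <;> simp [hx]

/-- Every measurable function of finite associate norm is represented in the associate space. -/
lemma BanachFunctionNorm.exists_mem_associateSpace [SigmaFinite μ] (ρ : BanachFunctionNorm μ)
    {ψ : Ω → ℝ≥0∞} (hψ : Measurable ψ) (h : ρ.associate ψ < ∞) :
    ∃ φ ∈ ρ.associateSpace, modulus φ =ᵐ[μ] ψ := by
  have hm : Measurable fun x => ((ψ x).toReal : ℂ) :=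
    Complex.measurable_ofReal.comp hψ.ennreal_toReal
  have hφ : modulus (AEEqFun.mk _ hm.aestronglyMeasurable : Ω →ₘ[μ] ℂ) =ᵐ[μ] ψ := by
    filter_upwards [AEEqFun.coeFn_mk _ hm.aestronglyMeasurable (μ := μ),
      ρ.ae_lt_top_of_associate_lt_top hψ h] with x hx hfin
    rw [modulus, hx, ← ofReal_norm, Complex.norm_real, Real.norm_of_nonneg
      ENNReal.toReal_nonneg, ENNReal.ofReal_toReal hfin.ne]
  exact ⟨_, by rwa [associateSpace, mem_ofPred_eq, ρ.associate_congr_ae hφ], hφ⟩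

/-- This is the local embedding into `L¹` in dual form; through it `ξ` controls local `L¹`
distances. -/
lemma BanachFunctionNorm.associate_indicator_lt_top (ρ : BanachFunctionNorm μ) {E : Set Ω}
    (hE : MeasurableSet E) (hμE : μ E < ∞) : ρ.associate (E.indicator 1) < ∞ := by
  obtain ⟨C, hC⟩ := ρ.setLIntegral_le' E hE hμE
  refine lt_of_le_of_lt (ρ.associate_le_of_forall_unit (c := C) fun F hF hF1 => ?_)
    ENNReal.coe_lt_top
  calc ∫⁻ x, E.indicator 1 x * F x ∂μ = ∫⁻ x in E, F x ∂μ := by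
        rw [← lintegral_indicator hE]
        congr 1 with x
        by_cases hx : x ∈ E <;> simp [hx]
    _ ≤ C * ρ.toFun F := hC F hF
    _ ≤ C * 1 := by gcongr
    _ = C := mul_one _

lemma lintegral_mul_modulus_le_xiFunctional [IsResonant μ] (φ f : Ω →ₘ[μ] ℂ) :
    ∫⁻ x, modulus f x * modulus φ x ∂μ ≤ xiFunctional φ f := by
  rw [xiFunctional_eq_iSup]
  exact le_iSup₂_of_le (modulus φ) (measurable_modulus φ) (le_iSup
    (fun _ : Equimeasurable μ (modulus φ) (modulus φ) => ∫⁻ x, modulus f x * modulus φ x ∂μ)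
    fun _ _ => rfl)

/-- A function with finite pairing against the whole associate space belongs to the space. -/
theorem mem_space_of_xiFunctional_lt_top [SigmaFinite μ] [IsResonant μ]
    (ρ : RIBanachFunctionNorm μ) {g : Ω →ₘ[μ] ℂ}
    (h : ∀ φ ∈ ρ.associateSpace, xiFunctional φ g < ∞) : g ∈ ρ.space := by
  by_contra hg
  have hg' : ρ.toFun (modulus g) = ∞ := not_lt_top_iff.1 hg
  have hG := measurable_modulus g
  -- The growth `4 ^ k` beats the weights `2⁻¹ ^ k` that make the series `Φ` converge in the
  -- associate norm.
  choose ψ hψm hψ1 hψ using fun k : ℕ => ρ.exists_associate_le_one hG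
    (c := 4 ^ k) (by positivity) (by rw [hg']; exact ENNReal.coe_lt_top)
  set Φ : Ω → ℝ≥0∞ := fun x => ∑' k, 2⁻¹ ^ k * ψ k x
  have hΦm : Measurable Φ := .tsum fun k => (hψm k).const_mul _
  have hΦint : ∀ F, Measurable F →
      ∫⁻ x, Φ x * F x ∂μ = ∑' k : ℕ, 2⁻¹ ^ k * ∫⁻ x, ψ k x * F x ∂μ := by
    intro F hF
    simp only [Φ, ← ENNReal.tsum_mul_right, mul_assoc]
    rw [lintegral_tsum (f := fun k x => 2⁻¹ ^ k * (ψ k x * F x))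
      fun k => (((hψm k).mul hF).const_mul _).aemeasurable]
    refine tsum_congr fun k => lintegral_const_mul' _ _ ?_
    exact ENNReal.pow_ne_top (by simp)
  have hΦ : ρ.associate Φ < ∞ := by
    refine lt_of_le_of_lt (ρ.associate_le_of_forall_unit (c := 2) fun F hF hF1 => ?_) (by simp)
    rw [hΦint F hF]
    calc ∑' k : ℕ, 2⁻¹ ^ k * ∫⁻ x, ψ k x * F x ∂μ ≤ ∑' k : ℕ, 2⁻¹ ^ k * (1 : ℝ≥0∞) := by
          refine ENNReal.tsum_le_tsum fun k => mul_le_mul_right ?_ _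
          exact (lintegral_mul_le_associate _ hF (hF1.trans_lt ENNReal.one_lt_top)).trans
            (mul_le_one' (hψ1 k) hF1)
      _ = 2 := by simp only [mul_one, ENNReal.tsum_geometric, ENNReal.one_sub_inv_two, inv_inv]
  obtain ⟨φ, hφ, hφΦ⟩ := ρ.exists_mem_associateSpace hΦm hΦ
  refine (h φ hφ).ne (top_le_iff.1 ?_)
  refine le_trans ?_ (lintegral_mul_modulus_le_xiFunctional φ g)
  have hEq : ∫⁻ x, modulus g x * modulus φ x ∂μ = ∫⁻ x, Φ x * modulus g x ∂μ := by
    refine lintegral_congr_ae ?_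
    filter_upwards [hφΦ] with x hx
    rw [hx, mul_comm]
  rw [hEq, hΦint _ hG]
  refine le_of_tendsto'
    (ENNReal.tendsto_pow_atTop_nhds_top_iff.2 ENNReal.one_lt_two) fun k => ?_
  refine le_trans ?_ (ENNReal.le_tsum k)
  calc (2 : ℝ≥0∞) ^ k = 2⁻¹ ^ k * ((4 ^ k : ℝ≥0) : ℝ≥0∞) := by
        push_cast
        rw [← mul_pow, show (4 : ℝ≥0∞) = 2 * 2 by norm_num, ← mul_assoc,
          ENNReal.inv_mul_cancel (by simp) (by simp), one_mul]
    _ ≤ _ := by gcongr; exact hψ k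

/-! ### Almost everywhere limits -/

/-- Lower semicontinuity of `|·|_φ` along almost everywhere convergent sequences. -/
lemma xiFunctional_sub_le_of_tendsto_ae [IsResonant μ] {φ f g : Ω →ₘ[μ] ℂ} {F : ℕ → Ω →ₘ[μ] ℂ}
    {c : ℝ≥0∞} (hF : ∀ᵐ x ∂μ, Tendsto (fun n => F n x) atTop (𝓝 (g x)))
    (hc : ∀ n, xiFunctional φ (f - F n) ≤ c) : xiFunctional φ (f - g) ≤ c := by
  simp only [xiFunctional_eq_iSup φ, iSup_le_iff] at hc ⊢
  intro h hh he
  calc ∫⁻ x, modulus (f - g) x * h x ∂μ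
      ≤ ∫⁻ x, liminf (fun n => modulus (f - F n) x * h x) atTop ∂μ := by
        refine lintegral_mono_ae ?_
        filter_upwards [hF, modulus_sub f g, ae_all_iff.2 fun n => modulus_sub f (F n)]
          with x hx h1 h2
        simp only [h1, h2]
        -- `h x` may be `∞`, and multiplication by `∞` is discontinuous at `0`; there the left side
        -- vanishes.
        rcases eq_or_ne (edist (f x) (g x)) 0 with h0 | h0
        · simp [h0]
        · exact (ENNReal.Tendsto.mul_const (tendsto_const_nhds.edist hx)
            (Or.inl h0)).liminf_eq.ge
    _ ≤ liminf (fun n => ∫⁻ x, modulus (f - F n) x * h x ∂μ) atTop :=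
        lintegral_liminf_le fun n => (measurable_modulus _).mul hh
    _ ≤ c := liminf_le_of_frequently_le' (Frequently.of_forall fun n => hc n h hh he)

lemma ae_tsum_indicator_ne_top [SigmaFinite μ] {u : ℕ → Ω → ℝ≥0∞} (hu : ∀ n, Measurable (u n))
    (h : ∀ n, ∫⁻ x in spanningSets μ n, u n x ∂μ ≤ 2⁻¹ ^ n) :
    ∀ᵐ x ∂μ, ∑' n, (spanningSets μ n).indicator (u n) x ≠ ∞ := by
  have hm : ∀ n, Measurable ((spanningSets μ n).indicator (u n)) := fun n =>
    (hu n).indicator (measurableSet_spanningSets μ n)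
  have := ae_lt_top (μ := μ) (Measurable.tsum (L := .unconditional ℕ) hm) ?_
  · filter_upwards [this] with x hx using hx.ne
  · rw [lintegral_tsum fun n => (hm n).aemeasurable]
    simp only [lintegral_indicator (measurableSet_spanningSets μ _)]
    refine ne_top_of_le_ne_top ?_ (ENNReal.tsum_le_tsum h)
    simp [ENNReal.tsum_geometric]

/-- Sequences selected from a decreasing sequence of sets of geometrically decreasing local
`L¹`-diameter converge almost everywhere to a common limit. -/
lemma exists_forall_tendsto_ae [SigmaFinite μ] {A : ℕ → Set (Ω →ₘ[μ] ℂ)} (hA : Antitone A)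
    (hne : ∀ n, (A n).Nonempty)
    (h : ∀ n, ∀ f ∈ A n, ∀ f' ∈ A n, ∫⁻ x in spanningSets μ n, modulus (f - f') x ∂μ ≤ 2⁻¹ ^ n) :
    ∃ g : Ω →ₘ[μ] ℂ, ∀ f : ℕ → Ω →ₘ[μ] ℂ, (∀ n, f n ∈ A n) →
      ∀ᵐ x ∂μ, Tendsto (fun n => f n x) atTop (𝓝 (g x)) := by
  choose a ha using hne
  have hev : ∀ x, ∀ᶠ n in atTop, x ∈ spanningSets μ n := fun x => by
    filter_upwards [eventually_ge_atTop (spanningSetsIndex μ x)] with n hn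
      using mem_spanningSets_of_index_le μ x hn
  have hlim : ∀ᵐ x ∂μ, ∃ l, Tendsto (fun n => a n x) atTop (𝓝 l) := by
    filter_upwards [ae_tsum_indicator_ne_top (fun n => measurable_modulus (a n - a (n + 1)))
      (fun n => h n _ (ha n) _ (hA n.le_succ (ha _))),
      ae_all_iff.2 fun n => modulus_sub (a n) (a (n + 1))] with x hx h1
    obtain ⟨N, hN⟩ := eventually_atTop.1 (hev x)
    -- From index `N` on, `x` lies in every spanning set, so the summable indicators bound the
    -- actual increments.
    have hc : CauchySeq fun n => a (n + N) x := by
      refine cauchySeq_of_edist_le_of_tsum_ne_top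
        (fun n => (spanningSets μ (n + N)).indicator (modulus (a (n + N) - a (n + N + 1))) x)
        (fun n => ?_) ?_
      · rw [indicator_of_mem (hN _ (Nat.le_add_left _ _)), h1, Nat.succ_add_eq_add_succ]
        rfl
      · refine ne_top_of_le_ne_top hx ?_
        exact ENNReal.tsum_comp_le_tsum_of_injective (add_left_injective N)
          (fun n => (spanningSets μ n).indicator (modulus (a n - a (n + 1))) x)
    obtain ⟨l, hl⟩ := cauchySeq_tendsto_of_complete hc
    exact ⟨l, (tendsto_add_atTop_iff_nat N).1 hl⟩
  obtain ⟨g, hg, hag⟩ := measurable_limit_of_tendsto_metrizable_ae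
    (fun n => (a n).measurable.aemeasurable) hlim
  refine ⟨AEEqFun.mk g hg.aestronglyMeasurable, fun f hf => ?_⟩
  filter_upwards [hag, AEEqFun.coeFn_mk g hg.aestronglyMeasurable (μ := μ),
    ae_tsum_indicator_ne_top (fun n => measurable_modulus (f n - a n))
      (fun n => h n _ (hf n) _ (ha n)),
    ae_all_iff.2 fun n => modulus_sub (f n) (a n)] with x hx hgx hs h1
  rw [hgx]
  -- `f n` and `a n` both lie in `A n`, so their local distances are summable too and the limits
  -- agree.
  have h0 : Tendsto (fun n => edist (f n x) (a n x)) atTop (𝓝 0) := by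
    have := ENNReal.tendsto_atTop_zero_of_tsum_ne_top hs
    refine this.congr' ?_
    filter_upwards [hev x] with n hn
    rw [indicator_of_mem hn, h1]
  rw [tendsto_iff_edist_tendsto_0] at hx ⊢
  exact tendsto_of_tendsto_of_tendsto_of_le_of_le tendsto_const_nhds
    (by simpa using h0.add hx) (fun _ => zero_le) fun n => edist_triangle _ _ _

/-! ### Completeness of `(X, ξ)` -/

section Completeness

variable [IsResonant μ] (ρ : RIBanachFunctionNorm μ)

lemma exists_mem_forall_xiFunctional_sub_le {F : Filter ρ.space}
    (hF : @Cauchy _ (xiUniformSpace ρ) F) {φ : Ω →ₘ[μ] ℂ} (hφ : φ ∈ ρ.associateSpace)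
    {ε : ℝ≥0∞} (hε : 0 < ε) :
    ∃ A ∈ F, ∀ f ∈ A, ∀ f' ∈ A, xiFunctional φ (f - f' : Ω →ₘ[μ] ℂ) ≤ ε := by
  obtain ⟨δ, hδ0, hδ⟩ := ENNReal.lt_iff_exists_nnreal_btwn.1 hε
  let _ := (xiSeminorm ρ ⟨φ, hφ⟩).toSeminormedAddCommGroup
  have hF' : Cauchy F := ⟨hF.1, hF.2.trans
    (iInf_le (fun φ => (xiSeminorm ρ φ).toSeminormedAddCommGroup.toUniformSpace) ⟨φ, hφ⟩)⟩
  obtain ⟨A, hA, hd⟩ := (Metric.cauchy_iff.1 hF').2 δ (by exact_mod_cast hδ0)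
  refine ⟨A, hA, fun f hf f' hf' => ?_⟩
  have h1 : (xiFunctional φ (f - f' : Ω →ₘ[μ] ℂ)).toReal < δ := by
    have := hd f hf f' hf'
    rw [dist_eq_norm] at this
    exact this
  -- Needed because `toReal` sends `∞` to `0`.
  have hfin := (xiFunctional_lt_top ρ hφ (f - f').2).ne
  rw [← ENNReal.ofReal_toReal (a := xiFunctional φ (f - f' : Ω →ₘ[μ] ℂ)) hfin]
  refine le_trans (ENNReal.ofReal_le_ofReal h1.le) ?_
  rw [ENNReal.ofReal_coe_nnreal]
  exact hδ.le

lemma le_nhds_of_forall_xiFunctional_sub_le {F : Filter ρ.space} {g : ρ.space}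
    (h : ∀ φ ∈ ρ.associateSpace, ∀ ε : ℝ≥0∞, 0 < ε →
      ∃ A ∈ F, ∀ f ∈ A, xiFunctional φ (f - g : Ω →ₘ[μ] ℂ) ≤ ε) :
    F ≤ @nhds _ (xiTopology ρ) g := by
  let _ := xiTopology ρ
  refine ((withSeminorms_xi ρ).tendsto_nhds id g).2 fun φ ε hε => ?_
  obtain ⟨A, hA, hAε⟩ := h φ φ.2 (ENNReal.ofReal (ε / 2)) (by simpa using hε)
  filter_upwards [hA] with f hf
  refine lt_of_le_of_lt (ENNReal.toReal_le_of_le_ofReal (by positivity) (hAε f hf)) ?_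
  linarith

theorem completeSpace_xi [SigmaFinite μ] : @CompleteSpace ρ.space (xiUniformSpace ρ) := by
  refine @CompleteSpace.mk _ (xiUniformSpace ρ) fun {F} hF => ?_
  have : F.NeBot := hF.1
  have hstep : ∀ n : ℕ, ∃ A ∈ F, ∀ f ∈ A, ∀ f' ∈ A,
      ∫⁻ x in spanningSets μ n, modulus (f - f' : Ω →ₘ[μ] ℂ) x ∂μ ≤ 2⁻¹ ^ n := by
    intro n
    have hE := measurableSet_spanningSets μ n
    obtain ⟨φ, hφ, hφE⟩ := ρ.exists_mem_associateSpace (measurable_one.indicator hE)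
      (ρ.associate_indicator_lt_top hE (measure_spanningSets_lt_top μ n))
    obtain ⟨A, hA, hAn⟩ := exists_mem_forall_xiFunctional_sub_le ρ hF hφ
      (ε := 2⁻¹ ^ n) (ENNReal.pow_pos (by simp) n)
    refine ⟨A, hA, fun f hf f' hf' => le_trans (le_of_eq ?_)
      ((lintegral_mul_modulus_le_xiFunctional φ _).trans (hAn f hf f' hf'))⟩
    rw [← lintegral_indicator hE]
    refine lintegral_congr_ae ?_
    filter_upwards [hφE] with x hx
    by_cases hxE : x ∈ spanningSets μ n <;> simp [hx, hxE]
  choose A hA hAn using hstep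
  set B : ℕ → Set ρ.space := fun n => ⋂ k ≤ n, A k
  have hB : ∀ n, B n ∈ F := fun n => (biInter_mem (finite_Iic n)).2 fun k _ => hA k
  have hBA : ∀ n, B n ⊆ A n := fun n => biInter_subset_of_mem (t := A) (mem_Iic.2 le_rfl)
  have hBanti : Antitone B := fun m n hmn =>
    biInter_subset_biInter_left fun k hk => le_trans hk hmn
  obtain ⟨g, hg⟩ := exists_forall_tendsto_ae (A := fun n => ((↑) : ρ.space → Ω →ₘ[μ] ℂ) '' B n)
    (fun m n hmn => image_mono (hBanti hmn)) (fun n => (F.nonempty_of_mem (hB n)).image _) (by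
      rintro n _ ⟨f, hf, rfl⟩ _ ⟨f', hf', rfl⟩
      exact hAn n f (hBA n hf) f' (hBA n hf'))
  have happrox : ∀ φ ∈ ρ.associateSpace, ∀ ε : ℝ≥0∞, 0 < ε →
      ∃ A ∈ F, ∀ f ∈ A, xiFunctional φ (f - g : Ω →ₘ[μ] ℂ) ≤ ε := by
    intro φ hφ ε hε
    obtain ⟨C, hC, hCε⟩ := exists_mem_forall_xiFunctional_sub_le ρ hF hφ hε
    refine ⟨C, hC, fun f hf => ?_⟩
    -- The selection depends on `φ` and `ε`, but its limit does not: any choice from the `B n`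
    -- converges a.e. to `g`. This is how sequences suffice for an arbitrary Cauchy filter.
    choose a ha using fun n => F.nonempty_of_mem (inter_mem hC (hB n))
    exact xiFunctional_sub_le_of_tendsto_ae
      (hg (fun n => a n) fun n => mem_image_of_mem _ (ha n).2) fun n => hCε f hf _ (ha n).1
  have hgX : g ∈ ρ.space := by
    refine mem_space_of_xiFunctional_lt_top ρ fun φ hφ => ?_
    obtain ⟨C, hC, hC1⟩ := happrox φ hφ 1 one_pos
    obtain ⟨f, hf⟩ := F.nonempty_of_mem hC
    have hneg : xiFunctional φ (g - f : Ω →ₘ[μ] ℂ) ≤ 1 := by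
      have := xiFunctional_smul φ (-1) (f - g : Ω →ₘ[μ] ℂ)
      have hsmul : (-1 : ℂ) • (f - g : Ω →ₘ[μ] ℂ) = g - f :=
        (neg_one_smul ℂ _).trans (neg_sub _ _)
      rw [hsmul] at this
      rw [this]
      simpa using hC1 f hf
    have hadd := xiFunctional_add_le φ (g - f : Ω →ₘ[μ] ℂ) f
    rw [sub_add_cancel] at hadd
    exact hadd.trans_lt (ENNReal.add_lt_top.2
      ⟨hneg.trans_lt ENNReal.one_lt_top, xiFunctional_lt_top ρ hφ f.2⟩)
  exact ⟨⟨g, hgX⟩, le_nhds_of_forall_xiFunctional_sub_le ρ happrox⟩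

end Completeness

end RIBFS

theorem mainTheorem7 {Ω : Type*} [MeasurableSpace Ω] (μ : Measure Ω) [SigmaFinite μ]
    [RIBFS.IsResonant μ] (ρ : RIBFS.RIBanachFunctionNorm μ) :
    letI : UniformSpace ρ.space := RIBFS.xiUniformSpace ρ
    CompleteSpace ρ.space ∧
      ∀ (ι : Type*) [Preorder ι] [IsDirectedOrder ι] [Nonempty ι] (f : ι → ρ.space),
        CauchySeq f → ∃ g : ρ.space, Tendsto f atTop (𝓝 g) := by
  let _ : UniformSpace ρ.space := RIBFS.xiUniformSpace ρ
  have hc : CompleteSpace ρ.space := RIBFS.completeSpace_xi ρ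
  exact ⟨hc, fun _ _ _ _ _ hf => CompleteSpace.complete hf⟩
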